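/- **Theorem (Optimal $M$-term truncation property).** Let $(\Omega,\mathcal F,\mathbb P)$ be a probability space, let $\mathcal H$ be a real Hilbert space (not necessarily separable), let $v\in L^2(\Omega,\mathcal H)$, and put $v_0 := v-\mathbb E(v)$, where $\mathbb E(v)=\int_\Omega v\,d\mathbb P$ is the Bochner integral. Let $$ v=\mathbb E(v)+\sum_{r=1}^{R}\lambda_r^{1/2}\,Y_r\,\varphi_r $$ be a Karhunen–Loève expansion (KLE) of $v$, that is: $R\in\{0,1,2,\dots\}\cup\{\infty\}$; the sum converges in $L^2(\Omega,\mathcal H)$; $\lambda_r\in(0,\infty)$, $\lambda_1\ge\lambda_2\ge\cdots$ and $\sum_{r=1}^R\lambda_r=\|v_0\|^2_{L^2(\Omega,\mathcal H)}$; $\{Y_r\}_{r=1}^R$ is an orthonormal set in $L^2(\Omega)$ with $\mathbb E(Y_r)=0$ for all $r$; and $\{\varphi_r\}_{r=1}^R$ is an orthonormal set in $\mathcal H$. Let $M\ge 0$ be an integer with $M\le R$, let $\mathcal S\subseteq\mathcal H$ be a subspace of dimension $M$, and let $\mathbf P_{\mathcal S}$ be the orthogonal projection of $\mathcal H$ onto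 $\mathcal S$. Then $$ \|(\mathrm{id}_{\mathcal H}-\mathbf P_{\mathcal S})v_0\|^2_{L^2(\Omega,\mathcal H)}\ \ge\ \sum_{r>M}\lambda_r . \tag{$*$}$$ Equality holds in $(*)$ if $\mathcal S=\operatorname{span}\{\varphi_1,\dots,\varphi_M\}$. If $M=0$, or $M=R$, or $\lambda_M>\lambda_{M+1}$, then equality holds in $(*)$ if and only if $\mathcal S=\operatorname{span}\{\varphi_1,\dots,\varphi_M\}$. In general, equality holds in $(*)$ if and only if $\mathcal S=\operatorname{span}\{\varphi'_1,\dots,\varphi'_M\}$ for some KLE $v=\mathbb E(v)+\sum_{r=1}^R\lambda_r^{1/2}\,Y'_r\,\varphi'_r$ of $v$ (with the same $R$ and $\lambda_r$). -/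

import Mathlib

open MeasureTheory

noncomputable section

namespace KarhunenLoeve

variable {Ω H : Type*} [MeasurableSpace Ω] {P : Measure Ω}
  [NormedAddCommGroup H] [InnerProductSpace ℝ H]

/-- The index set `{1, …, R}` of an expansion with `R ∈ ℕ ∪ {∞}` terms, shifted to
`{0, …, R - 1}` (all of `ℕ` if `R = ∞`). -/
abbrev Index (R : ℕ∞) : Type := {r : ℕ // (r : ℕ∞) < R}

/-- The element `ω ↦ X ω • e` of `L²(Ω, H)`, for `X ∈ L²(Ω)` and `e ∈ H`. -/
def smulVec (X : Lp ℝ 2 P) (e : H) : Lp H 2 P :=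
  (ContinuousLinearMap.toSpanSingleton ℝ e).compLp X

/-- The action of a bounded operator `T` on `L²(Ω, H)`: `ω ↦ T (v ω)`. -/
def applyOp (T : H →L[ℝ] H) (v : Lp H 2 P) : Lp H 2 P := T.compLp v

/-- `v - E(v)`, with `E(v)` the Bochner integral of `v`. -/
def centered [IsProbabilityMeasure P] (v : Lp H 2 P) : Lp H 2 P :=
  v - Lp.const 2 P (∫ ω, v ω ∂P)

/-- `v = E(v) + ∑_{r ≤ R} λ_r^{1/2} Y_r φ_r` is a Karhunen-Loève expansion of `v`. -/
structure IsKLE [IsProbabilityMeasure P] (v : Lp H 2 P) (R : ℕ∞)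
    (lam : Index R → ℝ) (Y : Index R → Lp ℝ 2 P) (φ : Index R → H) : Prop where
  /-- The expansion, with convergence in the norm of `L²(Ω, H)`. -/
  expansion : HasSum (fun r => Real.sqrt (lam r) • smulVec (Y r) (φ r)) (centered v)
  lam_pos : ∀ r, 0 < lam r
  lam_antitone : Antitone lam
  lam_sum : HasSum lam (‖centered v‖ ^ 2)
  Y_orthonormal : Orthonormal ℝ Y
  Y_mean_zero : ∀ r, ∫ ω, Y r ω ∂P = 0
  φ_orthonormal : Orthonormal ℝ φ

/-- The span of the first `M` vectors of the family `φ`. -/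
def leadingSpan {R : ℕ∞} (φ : Index R → H) (M : ℕ) : Submodule ℝ H :=
  Submodule.span ℝ (φ '' {r | (r : ℕ) < M})

/-- `‖(id - P_S) (v - E(v))‖²` in `L²(Ω, H)`, with `P_S` the orthogonal projection onto `S`. -/
def truncationError [IsProbabilityMeasure P] (v : Lp H 2 P) (S : Submodule ℝ H)
    [S.HasOrthogonalProjection] : ℝ :=
  ‖applyOp (ContinuousLinearMap.id ℝ H - S.starProjection) (centered v)‖ ^ 2

/-- `∑_{r > M} λ_r`. -/
def tail {R : ℕ∞} (lam : Index R → ℝ) (M : ℕ) : ℝ :=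
  ∑' r : {r : Index R // M ≤ (r : ℕ)}, lam r

end KarhunenLoeve

end

/-! Put `p r = ‖P_S φ_r‖²`. Applying `id - P_S` to the expansion and using Pythagoras, the error is
`∑ λ_r (1 - p r)`. By Bessel, `t = ∑ p r ≤ M`. For `μ > 0` separating the first `M` eigenvalues from
the rest, error minus tail equals `∑ (λ_r - μ) (1_{r<M} - p r) + μ (M - t)`, and every term is
nonnegative (`tail_le_truncationError_and`).

Equality forces `t = M`, so `S` lies in the closed span of the `φ_r`, contains those with `λ_r > μ`
and is orthogonal to those with `λ_r < μ`. A spectral gap then determines `S`. Without one, `S` is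
free only inside the eigenspace of `μ`: a basis of `S` adapted to the eigenspaces extends to a full
family of eigenvectors (`exists_eigenvectors`), and such a family is again a KLE
(`IsKLE.of_eigenvectors`). -/

namespace KarhunenLoeve

/-! ### Fourier series and finite-dimensional projections -/

section Hilbert

variable {ι E : Type*} [NormedAddCommGroup E] [InnerProductSpace ℝ E]

open Filter Topology

/-- Pythagoras for an orthogonal series. -/
theorem hasSum_norm_sq_of_orthogonal {f : ι → E} {x : E} (hf : HasSum f x)
    (horth : ∀ i j, i ≠ j → inner ℝ (f i) (f j) = 0) :
    HasSum (fun i => ‖f i‖ ^ 2) (‖x‖ ^ 2) := by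
  have h1 : ∀ i, inner ℝ (f i) x = ‖f i‖ ^ 2 := fun i => by
    have h2 := hf.mapL (innerSL ℝ (f i))
    have h3 := hasSum_single (f := fun j => innerSL ℝ (f i) (f j)) i
      (fun j hj => by simpa using horth i j hj.symm)
    rw [← real_inner_self_eq_norm_sq]
    exact h2.unique h3
  have h4 := hf.mapL (innerSL ℝ x)
  simp only [innerSL_apply_apply, real_inner_self_eq_norm_sq] at h4
  exact h4.congr_fun fun i => by rw [real_inner_comm, h1]

/-- If Bessel's inequality is an equality at `x`, then `x` is the sum of its Fourier series. -/
theorem hasSum_fourier_of_hasSum_sq {g : ι → E} (hg : Orthonormal ℝ g) {x : E}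
    (hx : HasSum (fun i => inner ℝ (g i) x ^ 2) (‖x‖ ^ 2)) :
    HasSum (fun i => (inner ℝ (g i) x : ℝ) • g i) x := by
  classical
  -- The squared error of a partial sum is the Bessel defect.
  have key : ∀ s : Finset ι, ‖(∑ i ∈ s, (inner ℝ (g i) x : ℝ) • g i) - x‖ ^ 2 =
      ‖x‖ ^ 2 - ∑ i ∈ s, inner ℝ (g i) x ^ 2 := fun s => by
    rw [norm_sub_sq_real, sum_inner, ← real_inner_self_eq_norm_sq, hg.inner_sum]
    simp only [real_inner_smul_left, conj_trivial, ← pow_two]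
    ring
  have h1 : Tendsto (fun s : Finset ι => ‖(∑ i ∈ s, (inner ℝ (g i) x : ℝ) • g i) - x‖ ^ 2)
      atTop (𝓝 0) := by
    simp only [key]
    have := (tendsto_const_nhds (x := ‖x‖ ^ 2)).sub (show Tendsto _ _ _ from hx)
    simpa using this
  have h2 := h1.sqrt
  simp only [Real.sqrt_sq (norm_nonneg _), Real.sqrt_zero] at h2
  exact tendsto_iff_norm_sub_tendsto_zero.2 h2

/-- The vectors that are the sum of their Fourier series. -/
def fourierSubmodule (φ : ι → E) : Submodule ℝ E where
  carrier := {x | HasSum (fun i => (inner ℝ (φ i) x : ℝ) • φ i) x}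
  zero_mem' := by simp [hasSum_zero]
  add_mem' {x y} hx hy := by
    simpa [inner_add_right, add_smul] using HasSum.add hx hy
  smul_mem' c x hx := by
    simpa [real_inner_smul_right, mul_smul] using HasSum.const_smul c hx

theorem mem_fourierSubmodule {φ : ι → E} {x : E} :
    x ∈ fourierSubmodule φ ↔ HasSum (fun i => (inner ℝ (φ i) x : ℝ) • φ i) x := Iff.rfl

theorem self_mem_fourierSubmodule {φ : ι → E} (hφ : Orthonormal ℝ φ) (i : ι) :
    φ i ∈ fourierSubmodule φ := by
  classical
  rw [mem_fourierSubmodule]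
  have h : HasSum (fun j => (inner ℝ (φ j) (φ i) : ℝ) • φ j) _ := hasSum_single i
    (fun j hj => by simp [hφ.inner_eq_zero hj])
  simpa [hφ.norm_eq_one i] using h

theorem span_le_fourierSubmodule {φ : ι → E} (hφ : Orthonormal ℝ φ) (s : Set ι) :
    Submodule.span ℝ (φ '' s) ≤ fourierSubmodule φ := by
  rw [Submodule.span_le]
  rintro _ ⟨i, -, rfl⟩
  exact self_mem_fourierSubmodule hφ i

theorem hasSum_inner_mul_inner {φ : ι → E} {x : E} (hx : x ∈ fourierSubmodule φ) (y : E) :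
    HasSum (fun i => (inner ℝ (φ i) x : ℝ) * inner ℝ (φ i) y) (inner ℝ x y) := by
  have := (mem_fourierSubmodule.1 hx).mapL (innerSL ℝ y)
  simp only [innerSL_apply_apply, real_inner_smul_right] at this
  simpa only [real_inner_comm] using this

/-- The Fourier series of `x` reduces to a finite sum over `s`. -/
theorem mem_span_of_inner_eq_zero {φ : ι → E} {x : E} (hx : x ∈ fourierSubmodule φ)
    {s : Set ι} (hs : s.Finite) (h : ∀ i ∉ s, inner ℝ (φ i) x = 0) :
    x ∈ Submodule.span ℝ (φ '' s) := by
  have h1 := hasSum_sum_of_ne_finset_zero (f := fun i => (inner ℝ (φ i) x : ℝ) • φ i)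
    (s := hs.toFinset) (L := .unconditional ι) (fun i hi => by simp [h i (by simpa using hi)])
  rw [(mem_fourierSubmodule.1 hx).unique h1]
  exact Submodule.sum_mem _ fun i hi => Submodule.smul_mem _ _
    (Submodule.subset_span ⟨i, by simpa using hi, rfl⟩)

variable (S : Submodule ℝ E) [FiniteDimensional ℝ S]

theorem norm_sq_starProjection_add (x : E) :
    ‖S.starProjection x‖ ^ 2 + ‖(ContinuousLinearMap.id ℝ E - S.starProjection) x‖ ^ 2
      = ‖x‖ ^ 2 := by
  rw [S.norm_sq_eq_add_norm_sq_starProjection x, Submodule.starProjection_orthogonal]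

/-- The trace of the projection to `S`, along an orthonormal family, is at most `dim S`, with
equality only if `S` is contained in the closed span of the family. -/
theorem exists_hasSum_norm_sq_starProjection {φ : ι → E} (hφ : Orthonormal ℝ φ) :
    ∃ t : ℝ, HasSum (fun i => ‖S.starProjection (φ i)‖ ^ 2) t ∧ t ≤ Module.finrank ℝ S ∧
      (t = Module.finrank ℝ S → S ≤ fourierSubmodule φ) := by
  set b := stdOrthonormalBasis ℝ S
  have hb : ∀ j, ‖(b j : E)‖ ^ 2 = 1 := fun j => by
    rw [← Submodule.coe_norm, b.orthonormal.norm_eq_one j, one_pow]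
  -- Expanding in a basis of `S` lets the two sums be exchanged, leaving one Bessel sum for each `b
  -- j`.
  have hp : ∀ i, ‖S.starProjection (φ i)‖ ^ 2 = ∑ j, inner ℝ (φ i) (b j : E) ^ 2 := fun i => by
    rw [Submodule.starProjection_apply, ← Submodule.coe_norm, ← b.sum_sq_norm_inner_right]
    refine Finset.sum_congr rfl fun j _ => ?_
    rw [Submodule.inner_orthogonalProjectionOnto_eq_of_mem_left, Real.norm_eq_abs, sq_abs,
      real_inner_comm]
  have hsum : ∀ j, Summable fun i => inner ℝ (φ i) (b j : E) ^ 2 := fun j => by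
    simpa using hφ.inner_products_summable (x := (b j : E))
  have hle : ∀ j, ∑' i, inner ℝ (φ i) (b j : E) ^ 2 ≤ 1 := fun j => by
    simpa [hb j] using hφ.tsum_inner_products_le (x := (b j : E))
  have hcard : ∑ _j : Fin (Module.finrank ℝ S), (1 : ℝ) = Module.finrank ℝ S := by simp
  refine ⟨∑ j, ∑' i, inner ℝ (φ i) (b j : E) ^ 2, ?_, ?_, fun h => ?_⟩
  · simp only [hp]
    exact hasSum_sum fun j _ => (hsum j).hasSum
  · rw [← hcard]
    exact Finset.sum_le_sum fun j _ => hle j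
  -- Numbers at most 1 whose sum is their count all equal 1, so Bessel is sharp at every `b j`.
  · rw [← hcard, Finset.sum_eq_sum_iff_of_le fun j _ => hle j] at h
    have hbm : ∀ j, (b j : E) ∈ fourierSubmodule φ := fun j => by
      refine hasSum_fourier_of_hasSum_sq hφ ?_
      rw [hb j, ← h j (Finset.mem_univ j)]
      exact (hsum j).hasSum
    intro x hx
    have hr := congrArg Subtype.val (b.sum_repr ⟨x, hx⟩)
    simp only [Submodule.coe_sum, Submodule.coe_smul] at hr
    rw [← hr]
    exact Submodule.sum_mem _ fun j _ => Submodule.smul_mem _ _ (hbm j)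

end Hilbert

/-! ### Elementary tensors in `L²(Ω, H)` -/

section LTwo

variable {Ω H : Type*} [MeasurableSpace Ω] {P : Measure Ω}
  [NormedAddCommGroup H] [InnerProductSpace ℝ H]

theorem smulVec_ae (X : Lp ℝ 2 P) (e : H) : ∀ᵐ ω ∂P, smulVec X e ω = X ω • e := by
  filter_upwards [(ContinuousLinearMap.toSpanSingleton ℝ e).coeFn_compLp X] with ω h
  simpa [smulVec] using h

theorem inner_smulVec_right (v : Lp H 2 P) (X : Lp ℝ 2 P) (e : H) :
    inner ℝ v (smulVec X e) = inner ℝ ((innerSL ℝ e).compLp v) X := by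
  rw [L2.inner_def, L2.inner_def]
  refine integral_congr_ae ?_
  filter_upwards [smulVec_ae X e, (innerSL ℝ e).coeFn_compLp v] with ω h1 h2
  rw [h1, h2, real_inner_smul_right, innerSL_apply_apply, real_inner_comm]
  simp

theorem compLp_smulVec {G : Type*} [NormedAddCommGroup G] [NormedSpace ℝ G] (T : H →L[ℝ] G)
    (X : Lp ℝ 2 P) (e : H) :
    T.compLp (smulVec X e) = (ContinuousLinearMap.toSpanSingleton ℝ (T e)).compLp X := by
  refine Lp.ext ?_
  filter_upwards [smulVec_ae X e, T.coeFn_compLp (smulVec X e),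
    (ContinuousLinearMap.toSpanSingleton ℝ (T e)).coeFn_compLp X] with ω h1 h2 h3
  rw [h2, h1, h3]
  simp

theorem toSpanSingleton_compLp (X : Lp ℝ 2 P) (c : ℝ) :
    (ContinuousLinearMap.toSpanSingleton ℝ c).compLp X = c • X := by
  refine Lp.ext ?_
  filter_upwards [(ContinuousLinearMap.toSpanSingleton ℝ c).coeFn_compLp X,
    Lp.coeFn_smul c X] with ω h1 h2
  rw [h1, h2]
  simp [mul_comm]

/-- Because the inner product factors, orthogonality of the `Y r` alone keeps the expansion
orthogonal after an operator acts on the `φ r`. -/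
theorem inner_smulVec_smulVec (X X' : Lp ℝ 2 P) (e e' : H) :
    inner ℝ (smulVec X e) (smulVec X' e') = (inner ℝ X X' : ℝ) * inner ℝ e e' := by
  rw [inner_smulVec_right, compLp_smulVec, toSpanSingleton_compLp, real_inner_smul_left,
    innerSL_apply_apply, real_inner_comm e, mul_comm]

theorem hasSum_compLp {ι : Type*} {G : Type*} [NormedAddCommGroup G] [NormedSpace ℝ G]
    (T : H →L[ℝ] G) {f : ι → Lp H 2 P} {v : Lp H 2 P} (h : HasSum f v) :
    HasSum (fun i => T.compLp (f i)) (T.compLp v) :=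
  h.mapL (T.compLpL 2 P)

theorem compLp_const_smul {G : Type*} [NormedAddCommGroup G] [NormedSpace ℝ G]
    (T : H →L[ℝ] G) (c : ℝ) (v : Lp H 2 P) : T.compLp (c • v) = c • T.compLp v :=
  (T.compLpL 2 P).map_smul c v

variable [IsProbabilityMeasure P]

omit [InnerProductSpace ℝ H] in
theorem integrable_Lp_two (v : Lp H 2 P) : Integrable v P :=
  (Lp.memLp v).integrable (by norm_num)

theorem integral_centered [CompleteSpace H] (v : Lp H 2 P) : ∫ ω, centered v ω ∂P = 0 := by
  have h : ∀ᵐ ω ∂P, centered v ω = v ω - ∫ ω, v ω ∂P := by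
    filter_upwards [Lp.coeFn_sub v (Lp.const 2 P (∫ ω, v ω ∂P)),
      Lp.coeFn_const (p := 2) (μ := P) (c := ∫ ω, v ω ∂P)] with ω h1 h2
    rw [centered, h1, Pi.sub_apply, h2, Function.const_apply]
  rw [integral_congr_ae h, integral_sub (integrable_Lp_two v) (integrable_const _)]
  simp

theorem integral_inner_centered [CompleteSpace H] (v : Lp H 2 P) (e : H) :
    ∫ ω, (innerSL ℝ e).compLp (centered v) ω ∂P = 0 := by
  rw [integral_congr_ae ((innerSL ℝ e).coeFn_compLp' (centered v)),
    (innerSL ℝ e).integral_comp_comm (integrable_Lp_two _), integral_centered, map_zero]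

end LTwo

end KarhunenLoeve

namespace KarhunenLoeve

/-! ### Leading indices and the threshold -/

section Index

variable {R : ℕ∞} {M : ℕ}

/-- The first `M` indices. -/
def leading (R : ℕ∞) (M : ℕ) : Set (Index R) := {r | (r : ℕ) < M}

theorem finite_leading (R : ℕ∞) (M : ℕ) : (leading R M).Finite :=
  Set.Finite.preimage Subtype.val_injective.injOn (Set.finite_Iio M)

/-- The first `M` indices, as a copy of `Fin M`. -/
def leadingEquiv (hM : (M : ℕ∞) ≤ R) : Fin M ≃ leading R M where
  toFun i := ⟨⟨i, lt_of_lt_of_le (by exact_mod_cast i.2) hM⟩, i.2⟩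
  invFun r := ⟨r.1, r.2⟩
  left_inv _ := rfl
  right_inv _ := rfl

theorem natCard_leading (hM : (M : ℕ∞) ≤ R) : Nat.card (leading R M) = M := by
  rw [← Nat.card_congr (leadingEquiv hM), Nat.card_fin]

open Classical in
theorem hasSum_indicator_leading (hM : (M : ℕ∞) ≤ R) :
    HasSum (fun r : Index R => if (r : ℕ) < M then (1 : ℝ) else 0) M := by
  have h : HasSum (fun r : Index R => if (r : ℕ) < M then (1 : ℝ) else 0) _ :=
    hasSum_sum_of_ne_finset_zero (s := (finite_leading R M).toFinset)
    (fun r hr => if_neg (by simpa [leading] using hr))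
  convert h
  rw [Finset.sum_congr rfl (g := fun _ => 1) (fun r hr => if_pos (by simpa [leading] using hr))]
  rw [Finset.sum_const, ← Nat.card_eq_card_finite_toFinset, natCard_leading hM]
  simp

theorem hasSum_tail {lam : Index R → ℝ} (h : Summable lam) (M : ℕ) :
    HasSum (fun r : Index R => if (r : ℕ) < M then 0 else lam r) (tail lam M) := by
  have h1 := (h.subtype {r : Index R | M ≤ (r : ℕ)}).hasSum
  have h2 : HasSum (Set.indicator {r : Index R | M ≤ (r : ℕ)} lam) (tail lam M) :=
    hasSum_subtype_iff_indicator.1 h1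
  refine h2.congr_fun fun r => ?_
  by_cases hr : (r : ℕ) < M
  · simp [hr, Set.indicator]
  · simp [hr, Set.indicator, not_lt.1 hr]

/-- A number separating the first `M` values of an antitone family from the others. -/
theorem exists_threshold {lam : Index R → ℝ} (hpos : ∀ r, 0 < lam r) (hlam : Antitone lam)
    (hM : (M : ℕ∞) ≤ R) :
    ∃ μ : ℝ, 0 < μ ∧ (∀ r : Index R, (r : ℕ) < M → μ ≤ lam r) ∧
      (∀ r : Index R, M ≤ (r : ℕ) → lam r ≤ μ) ∧
      ((∀ i j : Index R, (i : ℕ) + 1 = M → (j : ℕ) = M → lam j < lam i) →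
        ∀ r : Index R, M ≤ (r : ℕ) → lam r < μ) := by
  cases M with
  -- There is no `λ_M` here; any positive number above all eigenvalues serves.
  | zero =>
    by_cases hR : R = 0
    · subst hR
      exact ⟨1, one_pos, fun r => absurd r.2 (by simp), fun r => absurd r.2 (by simp),
        fun _ r => absurd r.2 (by simp)⟩
    · let z : Index R := ⟨0, by simpa using pos_iff_ne_zero.2 hR⟩
      have hz : ∀ r, lam r < lam z + 1 := fun r =>
        lt_of_le_of_lt (hlam (show z ≤ r from Nat.zero_le _)) (lt_add_one _)
      exact ⟨lam z + 1, by linarith [hpos z], fun r hr => absurd hr (by simp),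
        fun r _ => (hz r).le, fun _ r _ => hz r⟩
  | succ m =>
    -- The zero-based index `m` is that of `λ_M`, so `μ = λ_M`.
    let z : Index R := ⟨m, lt_of_lt_of_le (by exact_mod_cast m.lt_succ_self) hM⟩
    refine ⟨lam z, hpos z, fun r hr => hlam (show (r : ℕ) ≤ m by omega),
      fun r hr => hlam (show m ≤ (r : ℕ) by omega), fun h r hr => ?_⟩
    let w : Index R := ⟨m + 1, lt_of_le_of_lt (by exact_mod_cast hr) r.2⟩
    exact lt_of_le_of_lt (hlam (show w ≤ r from hr)) (h z w rfl rfl)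

end Index

/-! ### The lower bound and the equality conditions -/

variable {Ω H : Type*} [MeasurableSpace Ω] {P : Measure Ω} [IsProbabilityMeasure P]
  [NormedAddCommGroup H] [InnerProductSpace ℝ H]
  {v : Lp H 2 P} {R : ℕ∞} {lam : Index R → ℝ} {Y : Index R → Lp ℝ 2 P} {φ : Index R → H}

theorem IsKLE.hasSum_truncationError (h : IsKLE v R lam Y φ) (S : Submodule ℝ H)
    [S.HasOrthogonalProjection] :
    HasSum (fun r => lam r * ‖(ContinuousLinearMap.id ℝ H - S.starProjection) (φ r)‖ ^ 2)
      (truncationError v S) := by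
  set T := ContinuousLinearMap.id ℝ H - S.starProjection with hT
  have h1 : HasSum (fun r => Real.sqrt (lam r) • smulVec (Y r) (T (φ r)))
      (applyOp T (centered v)) := by
    have := hasSum_compLp T h.expansion
    simp only [compLp_const_smul, compLp_smulVec] at this
    exact this
  have h2 := hasSum_norm_sq_of_orthogonal h1 (fun i j hij => by
    rw [real_inner_smul_left, real_inner_smul_right, inner_smulVec_smulVec,
      h.Y_orthonormal.inner_eq_zero hij]
    simp)
  refine h2.congr_fun fun r => ?_
  rw [← real_inner_self_eq_norm_sq (Real.sqrt (lam r) • smulVec (Y r) (T (φ r))),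
    real_inner_smul_left, real_inner_smul_right, inner_smulVec_smulVec,
    real_inner_self_eq_norm_sq, h.Y_orthonormal.norm_eq_one, real_inner_self_eq_norm_sq,
    ← mul_assoc, Real.mul_self_sqrt (h.lam_pos r).le]
  simp

/-- The identity holds for every `μ`: subtract `μ` times the series for `M - t` from that for error
minus tail. A separating `μ` gives all terms a sign. -/
theorem IsKLE.hasSum_truncationError_sub_tail (h : IsKLE v R lam Y φ) {M : ℕ}
    (hM : (M : ℕ∞) ≤ R) (S : Submodule ℝ H) [FiniteDimensional ℝ S] {t : ℝ}
    (ht : HasSum (fun r => ‖S.starProjection (φ r)‖ ^ 2) t) (μ : ℝ) :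
    HasSum (fun r => (lam r - μ) *
        ((if (r : ℕ) < M then 1 else 0) - ‖S.starProjection (φ r)‖ ^ 2))
      (truncationError v S - tail lam M - μ * (M - t)) := by
  have h1 := ((h.hasSum_truncationError S).sub (hasSum_tail h.lam_sum.summable M)).sub
    (((hasSum_indicator_leading hM).sub ht).mul_left μ)
  refine h1.congr_fun fun r => ?_
  have h2 := norm_sq_starProjection_add S (φ r)
  rw [h.φ_orthonormal.norm_eq_one] at h2
  rw [eq_sub_of_add_eq' h2]
  split_ifs <;> ring

theorem IsKLE.tail_le_truncationError_and (h : IsKLE v R lam Y φ) {M : ℕ}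
    (hM : (M : ℕ∞) ≤ R) (S : Submodule ℝ H) [FiniteDimensional ℝ S]
    (hS : Module.finrank ℝ S = M) {μ : ℝ} (hμ : 0 < μ)
    (hlt : ∀ r : Index R, (r : ℕ) < M → μ ≤ lam r)
    (hge : ∀ r : Index R, M ≤ (r : ℕ) → lam r ≤ μ) :
    tail lam M ≤ truncationError v S ∧ (truncationError v S = tail lam M →
      S ≤ fourierSubmodule φ ∧ (∀ r, μ < lam r → φ r ∈ S) ∧
      ∀ r, lam r < μ → ∀ x ∈ S, inner ℝ (φ r) x = 0) := by
  obtain ⟨t, ht, htM, hteq⟩ := exists_hasSum_norm_sq_starProjection S h.φ_orthonormal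
  rw [hS] at htM hteq
  have hs := h.hasSum_truncationError_sub_tail hM S ht μ
  have hp : ∀ r, ‖S.starProjection (φ r)‖ ^ 2 ≤ 1 := fun r => by
    have h2 := norm_sq_starProjection_add S (φ r)
    rw [h.φ_orthonormal.norm_eq_one] at h2
    nlinarith [sq_nonneg ‖(ContinuousLinearMap.id ℝ H - S.starProjection) (φ r)‖]
  have hnn : ∀ r, 0 ≤ (lam r - μ) *
      ((if (r : ℕ) < M then 1 else 0) - ‖S.starProjection (φ r)‖ ^ 2) := fun r => by
    split_ifs with hr
    · exact mul_nonneg (sub_nonneg.2 (hlt r hr)) (sub_nonneg.2 (hp r))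
    · exact mul_nonneg_of_nonpos_of_nonpos (sub_nonpos.2 (hge r (not_lt.1 hr)))
        (by simp)
  have h0 := hs.nonneg hnn
  have h1 : 0 ≤ μ * (M - t) := mul_nonneg hμ.le (sub_nonneg.2 htM)
  refine ⟨by linarith, fun heq => ?_⟩
  have h2 : μ * (M - t) = 0 := by linarith
  have h3 : truncationError v S - tail lam M - μ * (M - t) = 0 := by linarith
  rw [h3] at hs
  have h4 := (hasSum_zero_iff_of_nonneg hnn).1 hs
  refine ⟨hteq ?_, fun r hr => ?_, fun r hr x hx => ?_⟩
  · rcases mul_eq_zero.1 h2 with h5 | h5 <;> linarith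
  · have hrM : (r : ℕ) < M := not_le.1 fun hrM => absurd hr (hge r hrM).not_gt
    have h5 := congrFun h4 r
    simp only [hrM, if_true, Pi.zero_apply, mul_eq_zero, sub_ne_zero.2 hr.ne', false_or] at h5
    rw [Submodule.mem_iff_norm_starProjection, h.φ_orthonormal.norm_eq_one,
      ← sq_eq_sq₀ (norm_nonneg _) zero_le_one]
    linarith
  · have hrM : ¬ (r : ℕ) < M := fun hrM => absurd hr (hlt r hrM).not_gt
    have h5 := congrFun h4 r
    simp only [hrM, if_false, Pi.zero_apply, mul_eq_zero, sub_ne_zero.2 hr.ne, false_or,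
      zero_sub, neg_eq_zero, pow_eq_zero_iff two_ne_zero, norm_eq_zero,
      Submodule.starProjection_apply_eq_zero_iff] at h5
    rw [real_inner_comm]
    exact h5 x hx

/-! ### The leading span attains the bound -/

theorem finrank_leadingSpan (hφ : Orthonormal ℝ φ) {M : ℕ} (hM : (M : ℕ∞) ≤ R) :
    Module.finrank ℝ (leadingSpan φ M) = M := by
  have h := finrank_span_eq_card
    (hφ.linearIndependent.comp _ (Subtype.val_injective.comp (leadingEquiv hM).injective))
  rw [Fintype.card_fin] at h
  have h2 : leadingSpan φ M = Submodule.span ℝ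
      (Set.range (φ ∘ (Subtype.val ∘ leadingEquiv hM))) := by
    rw [leadingSpan, Set.range_comp, Set.range_comp, (leadingEquiv hM).range_eq_univ,
      Set.image_univ, Subtype.range_coe]
    rfl
  rw [h2, h]

theorem finiteDimensional_leadingSpan (φ : Index R → H) (M : ℕ) :
    FiniteDimensional ℝ (leadingSpan φ M) :=
  FiniteDimensional.span_of_finite ℝ ((finite_leading R M).image φ)

theorem IsKLE.truncationError_leadingSpan (h : IsKLE v R lam Y φ) {M : ℕ}
    {S : Submodule ℝ H} [S.HasOrthogonalProjection] (hS : S = leadingSpan φ M) :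
    truncationError v S = tail lam M := by
  have h1 := h.hasSum_truncationError S
  have h2 := hasSum_tail h.lam_sum.summable M
  refine h1.unique ?_
  convert h2 using 2 with r
  split_ifs with hr
  · have : φ r ∈ S := hS ▸ Submodule.subset_span ⟨r, hr, rfl⟩
    simp [Submodule.starProjection_eq_self_iff.2 this]
  · have : φ r ∈ Sᗮ := by
      rw [hS, leadingSpan, Submodule.mem_orthogonal]
      intro u hu
      induction hu using Submodule.span_induction with
      | mem x hx =>
        obtain ⟨s, hs, rfl⟩ := hx
        exact h.φ_orthonormal.inner_eq_zero fun hsr => hr (hsr ▸ hs)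
      | zero => simp
      | add x y _ _ hx hy => rw [inner_add_left, hx, hy, add_zero]
      | smul c x _ hx => rw [real_inner_smul_left, hx, mul_zero]
    simp [(Submodule.starProjection_apply_eq_zero_iff S).2 this, h.φ_orthonormal.norm_eq_one]

/-! ### The covariance form and new expansions -/

theorem IsKLE.hasSum_compLp_inner (h : IsKLE v R lam Y φ) (e : H) :
    HasSum (fun r => (Real.sqrt (lam r) * inner ℝ (φ r) e) • Y r)
      ((innerSL ℝ e).compLp (centered v)) := by
  have h1 := hasSum_compLp (innerSL ℝ e) h.expansion
  simpa only [compLp_const_smul, compLp_smulVec, toSpanSingleton_compLp, smul_smul,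
    innerSL_apply_apply, real_inner_comm] using h1

/-- This is the covariance operator as a bilinear form, diagonal in the `φ r`. -/
theorem IsKLE.hasSum_covariance (h : IsKLE v R lam Y φ) (e f : H) :
    HasSum (fun r => lam r * inner ℝ (φ r) e * inner ℝ (φ r) f)
      (inner ℝ ((innerSL ℝ e).compLp (centered v)) ((innerSL ℝ f).compLp (centered v))) := by
  have hY : ∀ r, inner ℝ ((innerSL ℝ f).compLp (centered v)) (Y r) =
      Real.sqrt (lam r) * inner ℝ (φ r) f := fun r => by
    have h1 := (h.hasSum_compLp_inner f).mapL (innerSL ℝ (Y r))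
    have h2 := hasSum_single
      (f := fun s => innerSL ℝ (Y r) ((Real.sqrt (lam s) * inner ℝ (φ s) f) • Y s)) r
      (fun s hs => by simp [h.Y_orthonormal.inner_eq_zero hs.symm])
    rw [real_inner_comm]
    refine (h1.unique h2).trans ?_
    simp [h.Y_orthonormal.norm_eq_one]
  have h1 := (h.hasSum_compLp_inner e).mapL (innerSL ℝ ((innerSL ℝ f).compLp (centered v)))
  simp only [innerSL_apply_apply, real_inner_smul_right, hY] at h1
  rw [real_inner_comm]
  refine h1.congr_fun fun r => ?_
  rw [mul_mul_mul_comm, Real.mul_self_sqrt (h.lam_pos r).le, mul_assoc]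

/-- An orthonormal family of eigenvectors of the covariance operator, with the same eigenvalues,
gives another expansion. -/
theorem IsKLE.of_eigenvectors [CompleteSpace H] (h : IsKLE v R lam Y φ) {φ' : Index R → H}
    (hφ' : Orthonormal ℝ φ') (hmem : ∀ r, φ' r ∈ fourierSubmodule φ)
    (heig : ∀ r s, lam s * inner ℝ (φ s) (φ' r) = lam r * inner ℝ (φ s) (φ' r)) :
    IsKLE v R lam (fun r => (Real.sqrt (lam r))⁻¹ • (innerSL ℝ (φ' r)).compLp (centered v))
      φ' := by
  have hsq : ∀ r, Real.sqrt (lam r) ≠ 0 := fun r => (Real.sqrt_pos.2 (h.lam_pos r)).ne'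
  have hcov : ∀ r s, inner ℝ ((innerSL ℝ (φ' r)).compLp (centered v))
      ((innerSL ℝ (φ' s)).compLp (centered v)) = lam r * inner ℝ (φ' r) (φ' s) := fun r s => by
    refine (h.hasSum_covariance (φ' r) (φ' s)).unique ?_
    -- `heig` is the eigenvector equation in coordinates; it pulls `lam r` out, and Parseval sums
    -- the rest.
    simp only [heig, mul_assoc]
    exact (hasSum_inner_mul_inner (hmem r) (φ' s)).mul_left _
  set Y' : Index R → Lp ℝ 2 P :=
    fun r => (Real.sqrt (lam r))⁻¹ • (innerSL ℝ (φ' r)).compLp (centered v) with hY'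
  have hYo : Orthonormal ℝ Y' := by
    classical
    rw [orthonormal_iff_ite] at hφ' ⊢
    intro r s
    rw [hY']
    simp only [real_inner_smul_left, real_inner_smul_right]
    rw [hcov, hφ']
    split_ifs with hrs
    · subst hrs
      have := Real.mul_self_sqrt (h.lam_pos r).le
      have := hsq r
      field_simp
      rw [Real.sq_sqrt (h.lam_pos r).le]
    · simp
  have hg : Orthonormal ℝ fun r => smulVec (Y' r) (φ' r) := by
    classical
    rw [orthonormal_iff_ite] at hφ' hYo ⊢
    intro r s
    rw [inner_smulVec_smulVec, hφ', hYo]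
    split_ifs <;> simp
  have hin : ∀ r, inner ℝ (smulVec (Y' r) (φ' r)) (centered v) = Real.sqrt (lam r) :=
    fun r => by
      rw [real_inner_comm, inner_smulVec_right, hY', real_inner_smul_right, hcov,
        real_inner_self_eq_norm_sq, hφ'.norm_eq_one, one_pow, mul_one, inv_mul_eq_div,
        Real.div_sqrt]
  refine ⟨?_, h.lam_pos, h.lam_antitone, h.lam_sum, hYo, fun r => ?_, hφ'⟩
  -- The coefficients of `centered v` are `√λ_r`, whose squares sum to its squared norm: Bessel is
  -- sharp.
  · have h1 := hasSum_fourier_of_hasSum_sq hg (x := centered v) (by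
      simp only [hin, Real.sq_sqrt (h.lam_pos _).le]
      exact h.lam_sum)
    simpa only [hin] using h1
  · rw [hY', integral_congr_ae (Lp.coeFn_smul _ _)]
    simp only [Pi.smul_apply]
    rw [integral_smul, integral_inner_centered, smul_zero]

end KarhunenLoeve

/-! ### The subspaces attaining the bound -/

namespace KarhunenLoeve

variable {Ω H : Type*} [MeasurableSpace Ω] {P : Measure Ω} [IsProbabilityMeasure P]
  [NormedAddCommGroup H] [InnerProductSpace ℝ H]
  {v : Lp H 2 P} {R : ℕ∞} {lam : Index R → ℝ} {Y : Index R → Lp ℝ 2 P} {φ : Index R → H}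

theorem eq_leadingSpan_of_mem (hφ : Orthonormal ℝ φ) {M : ℕ} (hM : (M : ℕ∞) ≤ R)
    {S : Submodule ℝ H} [FiniteDimensional ℝ S] (hS : Module.finrank ℝ S = M)
    (hmem : ∀ r : Index R, (r : ℕ) < M → φ r ∈ S) : S = leadingSpan φ M := by
  refine (Submodule.eq_of_le_of_finrank_eq ?_ ?_).symm
  · rw [leadingSpan, Submodule.span_le]
    rintro _ ⟨r, hr, rfl⟩
    exact hmem r hr
  · rw [finrank_leadingSpan hφ hM, hS]

/-- A subspace of dimension `M` in the closed span of the family, orthogonal to all but its first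
`M` vectors, is the leading span. -/
theorem eq_leadingSpan_of_inner_eq_zero (hφ : Orthonormal ℝ φ) {M : ℕ} (hM : (M : ℕ∞) ≤ R)
    {S : Submodule ℝ H} (hS : Module.finrank ℝ S = M) (hle : S ≤ fourierSubmodule φ)
    (h0 : ∀ r : Index R, M ≤ (r : ℕ) → ∀ x ∈ S, inner ℝ (φ r) x = 0) :
    S = leadingSpan φ M := by
  have := finiteDimensional_leadingSpan φ M
  refine Submodule.eq_of_le_of_finrank_eq (fun x hx => ?_) ?_
  · exact mem_span_of_inner_eq_zero (hle hx) (finite_leading R M)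
      fun r hr => h0 r (not_lt.1 hr) x hx
  · rw [finrank_leadingSpan hφ hM, hS]

/-- An optimal subspace has an orthonormal basis of eigenvectors of the covariance operator that extends to an
orthonormal family of eigenvectors with the same eigenvalues. -/
theorem exists_eigenvectors (hφ : Orthonormal ℝ φ) {μ : ℝ} {M : ℕ} (hM : (M : ℕ∞) ≤ R)
    (hfin : {r | μ ≤ lam r}.Finite)
    (hlt : ∀ r : Index R, (r : ℕ) < M → μ ≤ lam r)
    (hge : ∀ r : Index R, M ≤ (r : ℕ) → lam r ≤ μ)
    {S : Submodule ℝ H} [FiniteDimensional ℝ S] (hS : Module.finrank ℝ S = M)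
    (hle : S ≤ fourierSubmodule φ) (hmem : ∀ r, μ < lam r → φ r ∈ S)
    (h0 : ∀ r, lam r < μ → ∀ x ∈ S, inner ℝ (φ r) x = 0) :
    ∃ φ' : Index R → H, Orthonormal ℝ φ' ∧ (∀ r, φ' r ∈ fourierSubmodule φ) ∧
      (∀ r s, lam s * inner ℝ (φ s) (φ' r) = lam r * inner ℝ (φ s) (φ' r)) ∧
      ∀ r : Index R, (r : ℕ) < M → φ' r ∈ S := by
  classical
  let _ : Fintype {r | μ ≤ lam r} := hfin.fintype
  let _ : Fintype (leading R M) := (finite_leading R M).fintype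
  have hlead : ∀ r, μ < lam r → (r : ℕ) < M := fun r hr =>
    not_le.1 fun hrM => absurd hr (hge r hrM).not_gt
  -- an orthonormal basis of `S` extending the `φ r` with `μ < lam r`
  obtain ⟨b, hb⟩ : ∃ b : OrthonormalBasis (leading R M) ℝ S, ∀ i : leading R M,
      μ < lam i → (b i : H) = φ i := by
    -- The value 0 is never used: only indices with `μ < lam i` are prescribed, where `hmem`
    -- applies.
    let w : leading R M → S := fun i => if h : φ i ∈ S then ⟨φ i, h⟩ else 0
    have hw : ∀ i : leading R M, μ < lam i → (w i : H) = φ i := fun i hi => by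
      simp [w, hmem i hi]
    have hwo : Orthonormal ℝ ({i : leading R M | μ < lam i}.domRestrict w) := by
      have h1 := hφ.comp (fun i : {i : leading R M | μ < lam i} => (i : leading R M).1)
        (Subtype.val_injective.comp Subtype.val_injective)
      rw [orthonormal_iff_ite] at h1 ⊢
      intro i j
      rw [← h1 i j, Submodule.coe_inner]
      exact congrArg₂ _ (hw _ i.2) (hw _ j.2)
    obtain ⟨b, hb⟩ := hwo.exists_orthonormalBasis_extension_of_card_eq
      (by rw [hS, ← Nat.card_eq_fintype_card, natCard_leading hM])
    exact ⟨b, fun i hi => by rw [hb i hi, hw i hi]⟩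
  -- `E` collects the eigenvectors with eigenvalue at least `μ`; it contains `S` and leaves room to
  -- complete its basis.
  set E := Submodule.span ℝ (φ '' {r | μ ≤ lam r}) with hE
  have : FiniteDimensional ℝ E := FiniteDimensional.span_of_finite ℝ (hfin.image φ)
  have hEr : Module.finrank ℝ E = Fintype.card {r | μ ≤ lam r} := by
    rw [← finrank_span_eq_card (hφ.linearIndependent.comp
      (Subtype.val : {r | μ ≤ lam r} → Index R) Subtype.val_injective), Set.range_comp,
      Subtype.range_coe]
  have hEK : E ≤ fourierSubmodule φ := span_le_fourierSubmodule hφ _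
  have hSE : S ≤ E := fun x hx => mem_span_of_inner_eq_zero (hle hx) hfin
    fun r hr => h0 r (not_le.1 hr) x hx
  have hE0 : ∀ r, lam r < μ → ∀ x ∈ E, inner ℝ (φ r) x = 0 := fun r hr x hx => by
    rw [hE] at hx
    induction hx using Submodule.span_induction with
    | mem x hx =>
      obtain ⟨s, hs, rfl⟩ := hx
      exact hφ.inner_eq_zero fun hrs => absurd hr (not_lt.2 (hrs ▸ hs))
    | zero => simp
    | add x y _ _ hx hy => rw [inner_add_right, hx, hy, add_zero]
    | smul c x _ hx => rw [real_inner_smul_right, hx, mul_zero]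
  -- an orthonormal basis of `E` extending `b`
  obtain ⟨c, hc⟩ : ∃ c : OrthonormalBasis {r | μ ≤ lam r} ℝ E, ∀ i : {r | μ ≤ lam r},
      ∀ h : (i : Index R) ∈ leading R M, (c i : H) = b ⟨i, h⟩ := by
    let w : {r | μ ≤ lam r} → E := fun i =>
      if h : (i : Index R) ∈ leading R M then ⟨b ⟨i, h⟩, hSE (b ⟨i, h⟩).2⟩ else 0
    have hw : ∀ i : {r | μ ≤ lam r}, ∀ h : (i : Index R) ∈ leading R M,
        (w i : H) = b ⟨i, h⟩ := fun i hi => by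
      simp [w, hi]
    have hwo : Orthonormal ℝ
        ({i : {r | μ ≤ lam r} | (i : Index R) ∈ leading R M}.domRestrict w) := by
      have h1 := b.orthonormal.comp
        (fun i : {i : {r | μ ≤ lam r} | (i : Index R) ∈ leading R M} =>
          (⟨i.1.1, i.2⟩ : leading R M))
        (fun i j hij => Subtype.ext (Subtype.ext
          (congrArg (Subtype.val : leading R M → Index R) hij)))
      rw [orthonormal_iff_ite] at h1 ⊢
      intro i j
      rw [← h1 i j, Submodule.coe_inner, Function.comp_apply, Function.comp_apply,
        Submodule.coe_inner]
      exact congrArg₂ _ (hw _ i.2) (hw _ j.2)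
    obtain ⟨c, hc⟩ := hwo.exists_orthonormalBasis_extension_of_card_eq hEr
    exact ⟨c, fun i hi => by rw [hc i hi, hw i hi]⟩
  have hcφ : ∀ i : {r | μ ≤ lam r}, μ < lam i → (c i : H) = φ i := fun i hi => by
    rw [hc i (hlead i hi), hb ⟨i, hlead i hi⟩ hi]
  -- Below `μ` the old eigenvectors are kept; they are orthogonal to `E`.
  refine ⟨fun r => if h : μ ≤ lam r then (c ⟨r, h⟩ : H) else φ r, ?_, fun r => ?_,
    fun r s => ?_, fun r hr => ?_⟩
  · have hco := c.orthonormal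
    rw [orthonormal_iff_ite] at hco
    rw [orthonormal_iff_ite]
    intro r s
    by_cases hr : μ ≤ lam r <;> by_cases hs : μ ≤ lam s
    · have := hco ⟨r, hr⟩ ⟨s, hs⟩
      rw [Submodule.coe_inner] at this
      simpa [hr, hs] using this
    · have hrs : r ≠ s := fun h => hs (h ▸ hr)
      simp only [hr, hs, dif_pos, dif_neg, hrs, if_false, not_false_eq_true]
      rw [real_inner_comm]
      exact hE0 s (not_le.1 hs) _ (c ⟨r, hr⟩).2
    · have hrs : r ≠ s := fun h => hr (h ▸ hs)
      simp only [hr, hs, dif_pos, dif_neg, hrs, if_false, not_false_eq_true]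
      exact hE0 r (not_le.1 hr) _ (c ⟨s, hs⟩).2
    · simpa [hr, hs] using (orthonormal_iff_ite.1 hφ) r s
  · dsimp only
    split_ifs with hr
    · exact hEK (c ⟨r, hr⟩).2
    · exact self_mem_fourierSubmodule hφ r
  · have hself : lam s * inner ℝ (φ s) (φ r) = lam r * inner ℝ (φ s) (φ r) := by
      by_cases hsr : s = r
      · rw [hsr]
      · rw [hφ.inner_eq_zero hsr, mul_zero, mul_zero]
    dsimp only
    split_ifs with hr
    · rcases hr.lt_or_eq with hr' | hr'
      · rwa [hcφ ⟨r, hr⟩ hr']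
      -- Here `lam r = μ`, and `c r` is orthogonal to each `φ s` with `lam s ≠ μ`, hence an
      -- eigenvector for `μ`.
      · rcases lt_trichotomy (lam s) μ with hs | hs | hs
        · rw [hE0 s hs _ (c ⟨r, hr⟩).2, mul_zero, mul_zero]
        · exact congrArg (· * _) (hs.trans hr')
        · have hsr : (⟨s, hs.le⟩ : {r | μ ≤ lam r}) ≠ ⟨r, hr⟩ := fun h => by
            rw [Subtype.mk.inj h] at hs
            exact absurd hr' hs.ne
          have := c.orthonormal.inner_eq_zero hsr
          rw [Submodule.coe_inner, hcφ ⟨s, hs.le⟩ hs] at this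
          rw [this, mul_zero, mul_zero]
    · exact hself
  · dsimp only
    rw [dif_pos (hlt r hr), hc ⟨r, hlt r hr⟩ hr]
    exact (b _).2

theorem IsKLE.finite_le (h : IsKLE v R lam Y φ) {μ : ℝ} (hμ : 0 < μ) :
    {r | μ ≤ lam r}.Finite := by
  have h1 := h.lam_sum.summable.tendsto_cofinite_zero.eventually (gt_mem_nhds hμ)
  simpa [Filter.eventually_cofinite] using h1

end KarhunenLoeve

/-! ### The main theorem -/

theorem mainTheorem3 {Ω H : Type*} [MeasurableSpace Ω] {P : Measure Ω} [IsProbabilityMeasure P]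
    [NormedAddCommGroup H] [InnerProductSpace ℝ H] [CompleteSpace H]
    (v : Lp H 2 P) (R : ℕ∞) (lam : KarhunenLoeve.Index R → ℝ)
    (Y : KarhunenLoeve.Index R → Lp ℝ 2 P) (φ : KarhunenLoeve.Index R → H)
    (hv : KarhunenLoeve.IsKLE v R lam Y φ)
    (M : ℕ) (hM : (M : ℕ∞) ≤ R)
    (S : Submodule ℝ H) [FiniteDimensional ℝ S] (hS : Module.finrank ℝ S = M) :
    -- the lower bound
    KarhunenLoeve.tail lam M ≤ KarhunenLoeve.truncationError v S ∧
    -- it is attained at the span of the first `M` vectors of the given expansion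
    (S = KarhunenLoeve.leadingSpan φ M →
      KarhunenLoeve.truncationError v S = KarhunenLoeve.tail lam M) ∧
    -- it is attained only there, if `λ_M > λ_{M+1}` (a void condition if `M = 0` or `M = R`)
    ((∀ i j : KarhunenLoeve.Index R, (i : ℕ) + 1 = M → (j : ℕ) = M → lam j < lam i) →
      (KarhunenLoeve.truncationError v S = KarhunenLoeve.tail lam M ↔
        S = KarhunenLoeve.leadingSpan φ M)) ∧
    -- in general, it is attained exactly at the spans of the first `M` vectors of the
    -- Karhunen-Loève expansions of `v`
    (KarhunenLoeve.truncationError v S = KarhunenLoeve.tail lam M ↔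
      ∃ (Y' : KarhunenLoeve.Index R → Lp ℝ 2 P) (φ' : KarhunenLoeve.Index R → H),
        KarhunenLoeve.IsKLE v R lam Y' φ' ∧ S = KarhunenLoeve.leadingSpan φ' M) := by
  obtain ⟨μ, hμ, hlt, hge, hgap⟩ :=
    KarhunenLoeve.exists_threshold hv.lam_pos hv.lam_antitone hM
  obtain ⟨hbound, heq⟩ :=
    hv.tail_le_truncationError_and hM S hS hμ hlt hge
  refine ⟨hbound, hv.truncationError_leadingSpan, fun hl => ⟨fun he => ?_,
    hv.truncationError_leadingSpan⟩, fun he => ?_, ?_⟩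
  · obtain ⟨hle, -, h0⟩ := heq he
    exact KarhunenLoeve.eq_leadingSpan_of_inner_eq_zero hv.φ_orthonormal hM hS hle
      fun r hr => h0 r (hgap hl r hr)
  · obtain ⟨hle, hmem, h0⟩ := heq he
    obtain ⟨φ', hφ', hφK, heig, hφS⟩ := KarhunenLoeve.exists_eigenvectors hv.φ_orthonormal hM
      (hv.finite_le hμ) hlt hge hS hle hmem h0
    exact ⟨_, φ', hv.of_eigenvectors hφ' hφK heig,
      KarhunenLoeve.eq_leadingSpan_of_mem hφ' hM hS hφS⟩
  · rintro ⟨Y', φ', hv', hS'⟩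
    exact hv'.truncationError_leadingSpan hS'
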